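/- Let $(\Gamma_n)_{n\ge 1}$ be the multiple gamma functions, that is, the family of functions, positive and $n+1$ times continuously differentiable on $(0,\infty)$ for each index $n$, such that for all integers $n\ge 1$ and all $x>0$ $$\Gamma_1(x)=\Gamma(x),\qquad \Gamma_{n+1}(x+1)=\frac{\Gamma_{n+1}(x)}{\Gamma_n(x)},\qquad \Gamma_n(1)=1,\qquad (-1)^{n+1}\frac{d^{n+1}}{dx^{n+1}}\log\Gamma_n(x)\ge 0 ,$$ where $\Gamma$ is Euler's gamma function. Such a family exists and is unique on $(0,\infty)$. For every integer $n\ge 1$, $$-(n-1)!\,\log\Gamma_n\!\left(\tfrac12\right)=-\frac{(2n-3)!!\,\log\pi}{2^n}+\log 2\sum_{k=1}^{n}\frac{P_{k,n}(\frac12)\,B_{k+1}}{(k+1)\,2^k}+\sum_{k=1}^{n}\frac{2^{k+1}-1}{2^k}\,P_{k,n}\!\left(\tfrac12\right)\zeta'(-k),$$ where $(-1)!!=1$, $B_m$ are the Bernoulli numbers, $\zeta'$ is the derivative of the Riemann zeta function, and $P_{k,n}(\frac12)$ is the coefficient of $x^k$ in $\prod_{j=1}^{n-1}\left(x+j-\frac12\right)$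 (the empty product, for $n=1$, being $1$). -/

import Mathlib

/-- `IsMultipleGamma Γ` says that `Γ 1, Γ 2, Γ 3, …`, viewed on the half line `(0, ∞)`, are the
multiple gamma functions: `Γ₁` is Euler's gamma function, `Γₙ₊₁(x+1) = Γₙ₊₁(x) / Γₙ(x)`,
`Γₙ(1) = 1`, and `(-1)^(n+1) (d/dx)^(n+1) log Γₙ(x) ≥ 0` for `x > 0`. Positivity and
`(n+1)`-fold continuous differentiability are what gives the last condition a meaning.
The values `Γ 0` and `Γ n x` with `x ≤ 0` play no role. -/
structure IsMultipleGamma (Γ : ℕ → ℝ → ℝ) : Prop where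
  pos : ∀ n : ℕ, 1 ≤ n → ∀ x : ℝ, 0 < x → 0 < Γ n x
  contDiffOn : ∀ n : ℕ, 1 ≤ n → ContDiffOn ℝ ((n + 1 : ℕ) : WithTop ℕ∞) (Γ n) (Set.Ioi 0)
  one_eq_Gamma : ∀ x : ℝ, 0 < x → Γ 1 x = Real.Gamma x
  recurrence : ∀ n : ℕ, 1 ≤ n → ∀ x : ℝ, 0 < x → Γ (n + 1) (x + 1) = Γ (n + 1) x / Γ n x
  at_one : ∀ n : ℕ, 1 ≤ n → Γ n 1 = 1
  convexity : ∀ n : ℕ, 1 ≤ n → ∀ x : ℝ, 0 < x →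
    0 ≤ (-1 : ℝ) ^ (n + 1) * iteratedDeriv (n + 1) (fun t : ℝ => Real.log (Γ n t)) x

/-- `multipleGammaCoeff k n z` is `P_{k,n}(z)`, the coefficient of `x ^ k` in
`∏_{j=1}^{n-1} (x + j - z)`. -/
noncomputable def multipleGammaCoeff (k n : ℕ) (z : ℝ) : ℝ :=
  (∏ j ∈ Finset.Icc 1 (n - 1),
    (Polynomial.X + Polynomial.C ((j : ℝ) - z) : Polynomial ℝ)).coeff k

/-! With `u = 1 - exp (-t)`, `log Γₙ(x)` is the integral over `t > 0` of `(exp (-x t) - exp (-t)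
Q(x)) / (uⁿ t)`, where `Q` interpolates `x ↦ (1 - u) ^ (x - 1)` at `1, …, n + 1`. Interpolation
makes the integral converge and vanish at `x = 1`; Newton's form of `Q` gives the recurrence
(`logGammaKernel_sub`); and since `Q` has degree at most `n`, the derivative of order `n + 1` in `x`
sees only the exponential and has a fixed sign. This proves existence. Uniqueness is a higher
Bohr–Mollerup argument (`eq_of_sub_add_one_eq`).

At `x = 1/2`, `t` times the integrand is a series of exponentials whose coefficients are values of
`∏ (x + j - 1/2)`, plus one multiple of `exp (-t)` (`mul_logGammaKernel`,
`hasSum_newtonPoly_div_pow`). Its Mellin transform is therefore `Γ(s)` times a combination of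
shifted zeta functions, for large `Re s` and then near `0` by continuation
(`eqOn_inv_Gamma_mul_mellin`). Since `1/Γ` vanishes at `0` with derivative `1`, differentiating at
`s = 0` isolates `log Γₙ(1/2)`. The term with `ζ(0)` and `ζ'(0)` becomes `log π` through the case `n
= 1`, where `Γ(1/2) = √π`. -/

/-! ### Newton interpolation of exponentials -/

open Polynomial Finset in
/-- The polynomial `x ↦ (x - 1).choose j`. -/
noncomputable def shiftedChoose (j : ℕ) : Polynomial ℝ :=
  Polynomial.C ((j.factorial : ℝ)⁻¹) *
    ∏ i ∈ Finset.range j, (Polynomial.X - Polynomial.C ((i : ℝ) + 1))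

theorem shiftedChoose_zero : shiftedChoose 0 = 1 := by simp [shiftedChoose]

theorem eval_shiftedChoose_succ (j : ℕ) (x : ℝ) :
    (shiftedChoose (j + 1)).eval x = (shiftedChoose j).eval x * (x - (j + 1)) / (j + 1) := by
  have : (j.factorial : ℝ) ≠ 0 := by positivity
  have : (j : ℝ) + 1 ≠ 0 := by positivity
  simp [shiftedChoose, Finset.prod_range_succ, Nat.factorial_succ, Polynomial.eval_mul]
  field_simp

theorem eval_shiftedChoose_succ_one (j : ℕ) : (shiftedChoose (j + 1)).eval 1 = 0 := by
  induction j with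
  | zero => simp [eval_shiftedChoose_succ]
  | succ j ih => rw [eval_shiftedChoose_succ, ih]; simp

theorem eval_shiftedChoose_succ_add_one (j : ℕ) (x : ℝ) :
    (shiftedChoose (j + 1)).eval (x + 1) = x / (j + 1) * (shiftedChoose j).eval x := by
  induction j with
  | zero => simp [eval_shiftedChoose_succ, shiftedChoose_zero]
  | succ j ih =>
    have : (j : ℝ) + 1 ≠ 0 := by positivity
    have : (j : ℝ) + 1 + 1 ≠ 0 := by positivity
    rw [eval_shiftedChoose_succ, ih, eval_shiftedChoose_succ]
    push_cast
    field_simp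
    ring

theorem eval_shiftedChoose_sub (j : ℕ) (x : ℝ) :
    (shiftedChoose (j + 1)).eval (x + 1) - (shiftedChoose (j + 1)).eval x =
      (shiftedChoose j).eval x := by
  have : (j : ℝ) + 1 ≠ 0 := by positivity
  rw [eval_shiftedChoose_succ_add_one, eval_shiftedChoose_succ]
  field_simp
  ring

theorem natDegree_shiftedChoose_le (j : ℕ) : (shiftedChoose j).natDegree ≤ j := by
  refine (Polynomial.natDegree_C_mul_le _ _).trans ?_
  refine (Polynomial.natDegree_prod_le _ _).trans ?_
  refine (Finset.sum_le_sum fun i _ => (Polynomial.natDegree_X_sub_C_le _)).trans ?_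
  simp

/-- The Newton interpolation polynomial of `x ↦ (1 - u) ^ (x - 1)` at the nodes `1, …, n + 1`. -/
noncomputable def newtonPoly (n : ℕ) (u : ℝ) : Polynomial ℝ :=
  ∑ j ∈ Finset.range (n + 1), Polynomial.C ((-u) ^ j) * shiftedChoose j

theorem natDegree_newtonPoly_le (n : ℕ) (u : ℝ) : (newtonPoly n u).natDegree ≤ n := by
  refine Polynomial.natDegree_sum_le_of_forall_le _ _ fun j hj => ?_
  refine (Polynomial.natDegree_C_mul_le _ _).trans ((natDegree_shiftedChoose_le j).trans ?_)
  simp at hj; omega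

theorem iterate_derivative_newtonPoly (n i : ℕ) (h : n < i) (u : ℝ) :
    Polynomial.derivative^[i] (newtonPoly n u) = 0 :=
  Polynomial.iterate_derivative_eq_zero ((natDegree_newtonPoly_le n u).trans_lt h)

theorem eval_newtonPoly (n : ℕ) (u x : ℝ) :
    (newtonPoly n u).eval x = ∑ j ∈ Finset.range (n + 1), (-u) ^ j * (shiftedChoose j).eval x := by
  simp [newtonPoly, Polynomial.eval_finsetSum]

/-- Pascal's rule lowers each binomial index by one; this is the source of the recurrence for `Γₙ`.
-/
theorem eval_newtonPoly_sub (n : ℕ) (u x : ℝ) :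
    (newtonPoly (n + 1) u).eval x - (newtonPoly (n + 1) u).eval (x + 1) =
      u * (newtonPoly n u).eval x := by
  rw [eval_newtonPoly, eval_newtonPoly, eval_newtonPoly, Finset.sum_range_succ',
    Finset.sum_range_succ' _ (n + 1), Finset.mul_sum, add_sub_add_comm, ← Finset.sum_sub_distrib]
  simp only [shiftedChoose_zero, Polynomial.eval_one, sub_self, add_zero]
  refine Finset.sum_congr rfl fun j _ => ?_
  rw [← eval_shiftedChoose_sub j]
  ring

theorem eval_newtonPoly_one (n : ℕ) (u : ℝ) : (newtonPoly n u).eval 1 = 1 := by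
  rw [eval_newtonPoly, Finset.sum_range_succ']
  simp [eval_shiftedChoose_succ_one, shiftedChoose_zero]

theorem eval_newtonPoly_node (u : ℝ) (m : ℕ) :
    ∀ n, m ≤ n → (newtonPoly n u).eval ((m : ℝ) + 1) = (1 - u) ^ m := by
  induction m with
  | zero => intro n _; simp [eval_newtonPoly_one]
  | succ m ih =>
    intro n hn
    obtain ⟨n, rfl⟩ : ∃ k, n = k + 1 := ⟨n - 1, by omega⟩
    have := eval_newtonPoly_sub n u (m + 1)
    rw [ih _ (by omega), ih _ (by omega)] at this
    push_cast
    rw [pow_succ]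
    linarith

theorem prod_Icc_mul_succ (g : ℕ → ℝ) (N : ℕ) :
    (∏ j ∈ Finset.Icc 1 N, g j) * g (N + 1) = g 1 * ∏ j ∈ Finset.Icc 1 N, g (j + 1) := by
  induction N with
  | zero => simp
  | succ N ih =>
    rw [Finset.prod_Icc_succ_top (by omega), ih, Finset.prod_Icc_succ_top (by omega)]
    ring

/-- The coefficients of the expansion of `newtonPoly N u / u ^ (N + 1)` in powers of `1 - u`. -/
theorem sum_shiftedChoose_mul_choose (x : ℝ) (N m : ℕ) :
    ∑ j ∈ Finset.range (N + 1), (-1) ^ j * (shiftedChoose j).eval x *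
        ((m + (N - j)).choose (N - j) : ℝ) =
      (∏ j ∈ Finset.Icc 1 N, ((m : ℝ) + 1 + (j - x))) / N.factorial := by
  induction N generalizing m with
  | zero => simp [shiftedChoose_zero]
  | succ N ihN =>
    have hN : (N.factorial : ℝ) ≠ 0 := by positivity
    have hN' : (N : ℝ) + 1 ≠ 0 := by positivity
    -- Double induction: Pascal's rule expresses the sum at `(N + 1, m + 1)` through those at `(N +
    -- 1, m)` and `(N, m + 1)`. At `m = 0` all binomials are `1`, so passing from `N` to `N + 1`
    -- only appends a term.
    induction m with
    | zero =>
      have h := ihN 0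
      simp only [zero_add, Nat.choose_self, Nat.cast_one, mul_one, CharP.cast_eq_zero] at h ⊢
      rw [Finset.sum_range_succ, h, Finset.prod_Icc_succ_top (by omega), Nat.factorial_succ]
      have key : (-1 : ℝ) ^ (N + 1) * (shiftedChoose (N + 1)).eval x =
          (∏ j ∈ Finset.Icc 1 N, (1 + ((j : ℝ) - x))) * (1 - x) / (N + 1).factorial := by
        clear ihN h hN hN'
        induction N with
        | zero => simp [eval_shiftedChoose_succ, shiftedChoose_zero]
        | succ N ih =>
          have hN : (N.factorial : ℝ) ≠ 0 := by positivity
          have hN' : (N : ℝ) + 1 ≠ 0 := by positivity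
          have hN' : (N : ℝ) + 1 + 1 ≠ 0 := by positivity
          rw [eval_shiftedChoose_succ, pow_succ, show ∀ a b c d : ℝ, a * -1 * (b * c / d) =
            (a * b) * (-c / d) from fun a b c d => by ring, ih,
            Finset.prod_Icc_succ_top (by omega), Nat.factorial_succ (N + 1)]
          push_cast
          field_simp
          ring
      rw [key, Nat.factorial_succ]
      push_cast
      field_simp
      ring
    | succ m ihm =>
      have h1 := ihN (m + 1)
      have h2 : ∑ j ∈ Finset.range (N + 2), (-1) ^ j * (shiftedChoose j).eval x *
          ((m + 1 + (N + 1 - j)).choose (N + 1 - j) : ℝ) =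
          ∑ j ∈ Finset.range (N + 2), (-1) ^ j * (shiftedChoose j).eval x *
            ((m + (N + 1 - j)).choose (N + 1 - j) : ℝ) +
          ∑ j ∈ Finset.range (N + 1), (-1) ^ j * (shiftedChoose j).eval x *
            ((m + 1 + (N - j)).choose (N - j) : ℝ) := by
        rw [Finset.sum_range_succ, Finset.sum_range_succ (n := N + 1),
          add_right_comm (Finset.sum _ _), ← Finset.sum_add_distrib]
        congr 1
        · refine Finset.sum_congr rfl fun j hj => ?_
          rw [← mul_add]
          congr 1
          rw [Finset.mem_range] at hj
          obtain ⟨r, rfl⟩ : ∃ r, N = j + r := ⟨N - j, by omega⟩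
          rw [show j + r + 1 - j = r + 1 by omega, show j + r - j = r by omega,
            show m + 1 + (r + 1) = (m + r + 1) + 1 by ring, Nat.choose_succ_succ,
            show m + r + 1 = m + (r + 1) by ring, show m + 1 + r = m + (r + 1) by ring]
          push_cast
          ring
        · simp
      rw [h2, ihm, h1, Finset.prod_Icc_succ_top (by omega), Finset.prod_Icc_succ_top (by omega)]
      have h3 : (∏ j ∈ Finset.Icc 1 N, ((m : ℝ) + 1 + (j - x))) * (m + 1 + ((N + 1 : ℕ) - x)) =
          (m + 1 + (1 - x)) * ∏ j ∈ Finset.Icc 1 N, (((m + 1 : ℕ) : ℝ) + 1 + (j - x)) := by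
        rw [prod_Icc_mul_succ (fun j : ℕ => (m : ℝ) + 1 + (j - x))]
        congr 1
        · simp
        · refine Finset.prod_congr rfl fun j _ => ?_
          push_cast
          ring
      rw [h3, Nat.factorial_succ]
      push_cast
      field_simp
      ring

/-! ### The integrand and its bounds -/

/-- The `i`-th `x`-derivative of the integrand representing `log Γₙ(x)`. -/
noncomputable def logGammaKernel (n i : ℕ) (x t : ℝ) : ℝ :=
  ((-t) ^ i * Real.exp (-x * t) - Real.exp (-t) *
    (Polynomial.derivative^[i] (newtonPoly n (1 - Real.exp (-t)))).eval x) /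
      ((1 - Real.exp (-t)) ^ n * t)

theorem hasDerivAt_logGammaKernel (n i : ℕ) (x t : ℝ) :
    HasDerivAt (fun x => logGammaKernel n i x t) (logGammaKernel n (i + 1) x t) x := by
  unfold logGammaKernel
  refine HasDerivAt.div_const (HasDerivAt.sub ?_ ?_) _
  · have h : HasDerivAt (fun x : ℝ => -x * t) (-t) x := by
      simpa using (hasDerivAt_id x).neg.mul_const t
    convert! (h.exp.const_mul ((-t) ^ i)) using 1
    ring
  · rw [Function.iterate_succ_apply']
    exact (Polynomial.hasDerivAt _ x).const_mul _

theorem one_sub_exp_neg_pos {t : ℝ} (ht : 0 < t) : 0 < 1 - Real.exp (-t) := by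
  have : Real.exp (-t) < 1 := by simpa using ht
  linarith

theorem logGammaKernel_node (n m : ℕ) (h : m ≤ n) (t : ℝ) :
    logGammaKernel n 0 (m + 1) t = 0 := by
  unfold logGammaKernel
  rw [Function.iterate_zero, id, eval_newtonPoly_node _ _ _ h, sub_sub_cancel, ← Real.exp_nat_mul,
    ← Real.exp_add, pow_zero, one_mul, show -((m : ℝ) + 1) * t = -t + m * -t by ring]
  simp

/-- More than `n` derivatives annihilate the interpolation polynomial. -/
theorem logGammaKernel_top (n l : ℕ) (x t : ℝ) :
    logGammaKernel n (n + 1 + l) x t =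
      (-t) ^ (n + 1 + l) * Real.exp (-x * t) / ((1 - Real.exp (-t)) ^ n * t) := by
  rw [logGammaKernel, iterate_derivative_newtonPoly _ _ (by omega)]
  simp

theorem logGammaKernel_sub (n : ℕ) (x : ℝ) {t : ℝ} (ht : 0 < t) :
    logGammaKernel (n + 1) 0 x t - logGammaKernel (n + 1) 0 (x + 1) t = logGammaKernel n 0 x t := by
  have hu := one_sub_exp_neg_pos ht
  have h := eval_newtonPoly_sub n (1 - Real.exp (-t)) x
  simp only [logGammaKernel, Function.iterate_zero, id, pow_zero, one_mul]
  rw [← sub_div, div_eq_div_iff (by positivity) (by positivity),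
    show -(x + 1) * t = -x * t + -t by ring, Real.exp_add, pow_succ]
  linear_combination (-Real.exp (-t)) * ((1 - Real.exp (-t)) ^ n * t) * h

/-- The inequality `1 + t ≤ exp t` bounds `t / (1 - exp (-t))` by `1 + t`, which removes the
singularity at `t = 0`. -/
theorem abs_logGammaKernel_top_le (n l : ℕ) (x : ℝ) {t : ℝ} (ht : 0 < t) :
    |logGammaKernel n (n + 1 + l) x t| ≤ (1 + t) ^ (n + l) * Real.exp (-x * t) := by
  have hu := one_sub_exp_neg_pos ht
  have htu : t ≤ (1 - Real.exp (-t)) * (1 + t) := by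
    have h1 : (1 + t) * Real.exp (-t) ≤ 1 := by
      rw [Real.exp_neg, mul_inv_le_iff₀ (Real.exp_pos t), one_mul, add_comm]
      exact Real.add_one_le_exp t
    linarith
  rw [logGammaKernel_top, abs_div, abs_mul, abs_of_pos (Real.exp_pos _), abs_pow, abs_neg,
    abs_of_pos ht, abs_of_pos (by positivity), div_le_iff₀ (by positivity)]
  calc t ^ (n + 1 + l) * Real.exp (-x * t)
      = t ^ n * t ^ l * t * Real.exp (-x * t) := by ring
    _ ≤ ((1 - Real.exp (-t)) * (1 + t)) ^ n * (1 + t) ^ l * t * Real.exp (-x * t) := by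
        gcongr; linarith
    _ = _ := by rw [mul_pow]; ring

/-- Iterated Rolle theorem. -/
theorem exists_iterated_deriv_eq_zero {f : ℕ → ℝ → ℝ}
    (hf : ∀ i x, HasDerivAt (f i) (f (i + 1) x) x) {A B : ℝ} (k : ℕ) :
    ∀ (i : ℕ) (a : ℕ → ℝ), (∀ j < k, a j < a (j + 1)) →
      (∀ j ≤ k, a j ∈ Set.Icc A B ∧ f i (a j) = 0) → ∃ ξ ∈ Set.Icc A B, f (i + k) ξ = 0 := by
  induction k with
  | zero => exact fun i a _ h => ⟨a 0, (h 0 le_rfl).1, (h 0 le_rfl).2⟩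
  | succ k ih =>
    intro i a ha h
    have hex : ∀ j, ∃ b, j ≤ k → b ∈ Set.Ioo (a j) (a (j + 1)) ∧ f (i + 1) b = 0 := by
      intro j
      by_cases hj : j ≤ k
      · obtain ⟨b, hb, hb0⟩ := exists_hasDerivAt_eq_zero (ha j (by omega))
          (fun y _ => (hf i y).continuousAt.continuousWithinAt)
          ((h j (by omega)).2.trans (h (j + 1) (by omega)).2.symm) (fun y _ => hf i y)
        exact ⟨b, fun _ => ⟨hb, hb0⟩⟩
      -- A dummy value: `choose` needs a point for every index.
      · exact ⟨0, fun h => absurd h hj⟩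
    choose b hb using hex
    obtain ⟨ξ, hξ, h0⟩ := ih (i + 1) b
      (fun j hj => (hb j (by omega)).1.2.trans (hb (j + 1) (by omega)).1.1)
      (fun j hj => ⟨⟨(h j (by omega)).1.1.trans (hb j hj).1.1.le,
        (hb j hj).1.2.le.trans (h (j + 1) (by omega)).1.2⟩, (hb j hj).2⟩)
    exact ⟨ξ, hξ, by rwa [show i + (k + 1) = i + 1 + k by ring]⟩

/-- The interpolation error estimate. By Rolle on the nodes, each derivative of order `i ≤ n` has a
zero in the interval, and the mean value inequality from that zero costs a factor `B - A` per order.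
-/
theorem abs_logGammaKernel_le_of_le (n : ℕ) {A B t C : ℝ} (hA : A ≤ 1) (hB : (n : ℝ) + 1 ≤ B)
    (hC : ∀ x ∈ Set.Icc A B, |logGammaKernel n (n + 1) x t| ≤ C) (l : ℕ) :
    ∀ i, i + l = n + 1 → ∀ x ∈ Set.Icc A B,
      |logGammaKernel n i x t| ≤ (B - A) ^ l * C := by
  induction l with
  | zero =>
    intro i hi x hx
    obtain rfl : i = n + 1 := by omega
    simpa using hC x hx
  | succ l ih =>
    intro i hi x hx
    obtain ⟨ξ, hξ, h0⟩ := exists_iterated_deriv_eq_zero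
      (f := fun i x => logGammaKernel n i x t) (A := A) (B := B)
      (fun i x => hasDerivAt_logGammaKernel n i x t) i 0 (fun j : ℕ => (j : ℝ) + 1)
      (fun j _ => by simp) (fun j hj => ⟨⟨by
        have : (0 : ℝ) ≤ j := by positivity
        linarith, by
        have : (j : ℝ) ≤ n := by exact_mod_cast (by omega : j ≤ n)
        linarith⟩, logGammaKernel_node n j (by omega) t⟩)
    rw [zero_add] at h0
    have hb := ih (i + 1) (by omega)
    have hC0 : 0 ≤ (B - A) ^ l * C := (abs_nonneg _).trans (hb x hx)
    have := (convex_Icc A B).norm_image_sub_le_of_norm_hasDerivWithin_le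
      (f := fun x => logGammaKernel n i x t)
      (fun y _ => (hasDerivAt_logGammaKernel n i y t).hasDerivWithinAt) hb hξ hx
    simp only [h0, sub_zero, Real.norm_eq_abs] at this
    refine this.trans ?_
    have h2 : |x - ξ| ≤ B - A := abs_le.2 ⟨by linarith [hx.1, hξ.2], by linarith [hx.2, hξ.1]⟩
    calc _ ≤ (B - A) ^ l * C * (B - A) := by gcongr
      _ = _ := by ring

theorem one_add_pow_mul_exp_le (k : ℕ) {ε : ℝ} (hε : 0 < ε) :
    ∃ C, 0 ≤ C ∧ ∀ t : ℝ, 0 < t →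
      (1 + t) ^ k * Real.exp (-ε * t) ≤ C * Real.exp (-(ε / 2) * t) := by
  -- The constant comes from `y ^ k / k! ≤ exp y` at `y = (1 + t) * ε / 2`, which spends half of the
  -- decay.
  refine ⟨k.factorial * (2 / ε) ^ k * Real.exp (ε / 2), by positivity, fun t ht => ?_⟩
  have h := Real.pow_div_factorial_le_exp (x := (1 + t) * (ε / 2)) (by positivity) k
  rw [div_le_iff₀ (by positivity)] at h
  have h1 : (1 + t) ^ k = ((1 + t) * (ε / 2)) ^ k * (2 / ε) ^ k := by
    rw [← mul_pow]; congr 1; field_simp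
  rw [h1]
  calc _ ≤ Real.exp ((1 + t) * (ε / 2)) * k.factorial * (2 / ε) ^ k * Real.exp (-ε * t) := by gcongr
    _ = k.factorial * (2 / ε) ^ k * (Real.exp ((1 + t) * (ε / 2)) * Real.exp (-ε * t)) := by ring
    _ = k.factorial * (2 / ε) ^ k * (Real.exp (ε / 2) * Real.exp (-(ε / 2) * t)) := by
        rw [← Real.exp_add, ← Real.exp_add]; ring_nf
    _ = _ := by ring

/-- Uniformity in `x` supplies the dominating function for differentiation under the integral. The
interval is enlarged to contain all the nodes. -/
theorem exists_abs_logGammaKernel_le (n i : ℕ) {ε : ℝ} (hε : 0 < ε) (R : ℝ) :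
    ∃ C, 0 ≤ C ∧ ∃ δ, 0 < δ ∧ ∀ t : ℝ, 0 < t → ∀ x ∈ Set.Icc ε R,
      |logGammaKernel n i x t| ≤ C * Real.exp (-δ * t) := by
  set A := min ε 1
  set B := max R (n + 1)
  have hA : 0 < A := lt_min hε one_pos
  have hn : (0 : ℝ) ≤ n := by positivity
  have hBA : 0 ≤ B - A := by
    have h1 : A ≤ 1 := min_le_right _ _
    have h2 : (n : ℝ) + 1 ≤ B := le_max_right _ _
    linarith
  have hsub : Set.Icc ε R ⊆ Set.Icc A B := Set.Icc_subset_Icc (min_le_left _ _) (le_max_left _ _)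
  have htop : ∀ l, ∀ t : ℝ, 0 < t → ∀ x ∈ Set.Icc A B,
      |logGammaKernel n (n + 1 + l) x t| ≤ (1 + t) ^ (n + l) * Real.exp (-A * t) := by
    intro l t ht x hx
    refine (abs_logGammaKernel_top_le n l x ht).trans ?_
    gcongr
    exact hx.1
  rcases le_or_gt (n + 1) i with hi | hi
  · obtain ⟨l, rfl⟩ := Nat.exists_eq_add_of_le hi
    obtain ⟨C, hC, h⟩ := one_add_pow_mul_exp_le (n + l) hA
    exact ⟨C, hC, A / 2, by positivity, fun t ht x hx =>
      (htop l t ht x (hsub hx)).trans (h t ht)⟩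
  · obtain ⟨C, hC, h⟩ := one_add_pow_mul_exp_le (n + 0) hA
    refine ⟨(B - A) ^ (n + 1 - i) * C, by positivity, A / 2, by positivity, fun t ht x hx => ?_⟩
    refine (abs_logGammaKernel_le_of_le n (min_le_right _ _) (le_max_right _ _)
      (fun y hy => htop 0 t ht y hy) (n + 1 - i) i (by omega) x (hsub hx)).trans ?_
    rw [mul_assoc]
    exact mul_le_mul_of_nonneg_left (h t ht) (by positivity)

theorem continuousOn_logGammaKernel (n i : ℕ) (x : ℝ) :
    ContinuousOn (logGammaKernel n i x) (Set.Ioi 0) := by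
  have h : ∀ t, (Polynomial.derivative^[i] (newtonPoly n (1 - Real.exp (-t)))).eval x =
      ∑ j ∈ Finset.range (n + 1), (-(1 - Real.exp (-t))) ^ j *
        (Polynomial.derivative^[i] (shiftedChoose j)).eval x := by
    intro t
    rw [newtonPoly, Polynomial.iterate_derivative_sum, Polynomial.eval_finsetSum]
    simp only [Polynomial.iterate_derivative_C_mul, Polynomial.eval_mul, Polynomial.eval_C]
  unfold logGammaKernel
  simp only [h]
  refine ContinuousOn.div (Continuous.continuousOn (by fun_prop)) (by fun_prop) ?_
  intro t ht
  have := one_sub_exp_neg_pos ht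
  have : 0 < t := ht
  positivity

theorem integrable_logGammaKernel (n i : ℕ) {x : ℝ} (hx : 0 < x) :
    MeasureTheory.IntegrableOn (logGammaKernel n i x) (Set.Ioi 0) := by
  obtain ⟨C, -, δ, hδ, h⟩ := exists_abs_logGammaKernel_le n i hx x
  refine MeasureTheory.Integrable.mono'
    ((integrableOn_exp_mul_Ioi (a := -δ) (by linarith) 0).const_mul C)
    ((continuousOn_logGammaKernel n i x).aestronglyMeasurable measurableSet_Ioi) ?_
  exact (MeasureTheory.ae_restrict_iff' measurableSet_Ioi).2
    (Filter.Eventually.of_forall fun t ht => h t ht x ⟨le_rfl, le_rfl⟩)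

/-! ### Existence from the integral representation -/

/-- The `i`-th derivative of `log Γₙ`, as an integral. -/
noncomputable def logGammaDeriv (n i : ℕ) (x : ℝ) : ℝ :=
  ∫ t in Set.Ioi 0, logGammaKernel n i x t

theorem hasDerivAt_logGammaDeriv (n i : ℕ) {x : ℝ} (hx : 0 < x) :
    HasDerivAt (logGammaDeriv n i) (logGammaDeriv n (i + 1) x) x := by
  obtain ⟨C, -, δ, hδ, h⟩ := exists_abs_logGammaKernel_le n (i + 1) (half_pos hx) (x + 1)
  refine (hasDerivAt_integral_of_dominated_loc_of_deriv_le
    (μ := MeasureTheory.volume.restrict (Set.Ioi 0))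
    (F := fun x t => logGammaKernel n i x t)
    (F' := fun x t => logGammaKernel n (i + 1) x t) (s := Set.Icc (x / 2) (x + 1))
    (bound := fun t => C * Real.exp (-δ * t))
    (Icc_mem_nhds (by linarith) (by linarith)) ?_ (integrable_logGammaKernel n i hx)
    (integrable_logGammaKernel n (i + 1) hx).aestronglyMeasurable ?_
    ((integrableOn_exp_mul_Ioi (a := -δ) (by linarith) 0).const_mul C) ?_).2
  · exact Filter.Eventually.of_forall fun y =>
      (continuousOn_logGammaKernel n i y).aestronglyMeasurable measurableSet_Ioi
  · exact (MeasureTheory.ae_restrict_iff' measurableSet_Ioi).2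
      (Filter.Eventually.of_forall fun t ht y hy => h t ht y hy)
  · exact Filter.Eventually.of_forall fun t y _ => hasDerivAt_logGammaKernel n i y t

theorem logGammaDeriv_sub (n : ℕ) {x : ℝ} (hx : 0 < x) :
    logGammaDeriv (n + 1) 0 x - logGammaDeriv (n + 1) 0 (x + 1) = logGammaDeriv n 0 x := by
  unfold logGammaDeriv
  rw [← MeasureTheory.integral_sub (integrable_logGammaKernel _ _ hx)
    (integrable_logGammaKernel _ _ (by linarith))]
  exact MeasureTheory.setIntegral_congr_fun measurableSet_Ioi
    fun t ht => logGammaKernel_sub n x ht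

theorem logGammaDeriv_one (n : ℕ) : logGammaDeriv n 0 1 = 0 := by
  have := logGammaKernel_node n 0 (by omega)
  simp only [CharP.cast_eq_zero, zero_add] at this
  simp [logGammaDeriv, this]

theorem logGammaDeriv_top_nonneg (n : ℕ) (x : ℝ) :
    0 ≤ (-1) ^ (n + 1) * logGammaDeriv n (n + 1) x := by
  rw [logGammaDeriv, ← MeasureTheory.integral_const_mul]
  refine MeasureTheory.setIntegral_nonneg measurableSet_Ioi fun t ht => ?_
  have hu := one_sub_exp_neg_pos ht
  have ht' : 0 < t := ht
  rw [show n + 1 = n + 1 + 0 from rfl, logGammaKernel_top, ← mul_div_assoc, ← mul_assoc, ← mul_pow]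
  simp only [neg_mul, one_mul, neg_neg]
  positivity

theorem tendsto_logGammaDeriv_top (n : ℕ) {x : ℝ} (hx : 0 < x) :
    Filter.Tendsto (fun m : ℕ => logGammaDeriv n (n + 1) (x + m)) Filter.atTop (nhds 0) := by
  have h0 : (0 : ℝ) = ∫ t in Set.Ioi (0 : ℝ), (0 : ℝ) := by simp
  rw [h0]
  refine MeasureTheory.tendsto_integral_of_dominated_convergence
    (fun t => |logGammaKernel n (n + 1) x t|)
    (fun m => (continuousOn_logGammaKernel n _ _).aestronglyMeasurable measurableSet_Ioi)
    (integrable_logGammaKernel n (n + 1) hx).abs (fun m => ?_) ?_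
  · refine (MeasureTheory.ae_restrict_iff' measurableSet_Ioi).2
      (Filter.Eventually.of_forall fun t ht => ?_)
    have hu := one_sub_exp_neg_pos ht
    have ht' : 0 < t := ht
    rw [show n + 1 = n + 1 + 0 from rfl, logGammaKernel_top, logGammaKernel_top, Real.norm_eq_abs,
      abs_div, abs_div, abs_mul, Real.abs_exp, abs_mul, abs_mul, Real.abs_exp]
    gcongr ?_ * Real.exp (?_ * t) / ?_
    have : (0 : ℝ) ≤ m := by positivity
    linarith
  · refine (MeasureTheory.ae_restrict_iff' measurableSet_Ioi).2
      (Filter.Eventually.of_forall fun t ht => ?_)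
    have ht' : 0 < t := ht
    rw [show n + 1 = n + 1 + 0 from rfl]
    simp only [logGammaKernel_top]
    have h1 : Filter.Tendsto (fun m : ℕ => Real.exp (-(x + m) * t)) Filter.atTop (nhds 0) := by
      refine Real.tendsto_exp_atBot.comp ?_
      simp only [neg_mul]
      refine Filter.tendsto_neg_atTop_atBot.comp ?_
      exact (Filter.tendsto_atTop_add_const_left _ x tendsto_natCast_atTop_atTop).atTop_mul_const ht'
    simpa using (h1.const_mul ((-t) ^ (n + 1 + 0))).div_const ((1 - Real.exp (-t)) ^ n * t)

theorem iteratedDeriv_eqOn_of_hasDerivAt {D : ℕ → ℝ → ℝ} {s : Set ℝ} (hs : IsOpen s)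
    (hD : ∀ i, ∀ x ∈ s, HasDerivAt (D i) (D (i + 1) x) x) (i : ℕ) :
    Set.EqOn (iteratedDeriv i (D 0)) (D i) s := by
  induction i with
  | zero => simp [Set.eqOn_refl]
  | succ i ih =>
    intro x hx
    rw [iteratedDeriv_succ, (ih.eventuallyEq_of_mem (hs.mem_nhds hx)).deriv_eq]
    exact (hD i x hx).deriv

theorem contDiffOn_of_hasDerivAt {D : ℕ → ℝ → ℝ} {s : Set ℝ} (hs : IsOpen s)
    (hD : ∀ i, ∀ x ∈ s, HasDerivAt (D i) (D (i + 1) x) x) (k i : ℕ) :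
    ContDiffOn ℝ k (D i) s := by
  induction k generalizing i with
  | zero =>
    rw [CharP.cast_eq_zero, contDiffOn_zero]
    exact fun x hx => (hD i x hx).continuousAt.continuousWithinAt
  | succ k ih =>
    push_cast
    rw [contDiffOn_succ_iff_deriv_of_isOpen hs]
    refine ⟨fun x hx => (hD i x hx).differentiableAt.differentiableWithinAt, by simp, ?_⟩
    exact (ih (i + 1)).congr fun x hx => (hD i x hx).deriv

theorem contDiffOn_logGammaDeriv (n k : ℕ) :
    ContDiffOn ℝ k (logGammaDeriv n 0) (Set.Ioi 0) :=
  contDiffOn_of_hasDerivAt isOpen_Ioi (fun i _ hx => hasDerivAt_logGammaDeriv n i hx) k 0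

theorem iteratedDeriv_logGammaDeriv (n i : ℕ) {x : ℝ} (hx : 0 < x) :
    iteratedDeriv i (logGammaDeriv n 0) x = logGammaDeriv n i x :=
  iteratedDeriv_eqOn_of_hasDerivAt isOpen_Ioi (fun i _ hx => hasDerivAt_logGammaDeriv n i hx) i hx

theorem logGammaDeriv_zero_one {x : ℝ} (hx : 0 < x) : logGammaDeriv 0 1 x = -x⁻¹ := by
  have h : ∀ t ∈ Set.Ioi (0 : ℝ), logGammaKernel 0 1 x t = -Real.exp (-x * t) := by
    intro t ht
    have ht' : t ≠ 0 := ne_of_gt ht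
    have := logGammaKernel_top 0 0 x t
    rw [show 0 + 1 + 0 = 1 from rfl] at this
    rw [this]
    field_simp
  rw [logGammaDeriv, MeasureTheory.setIntegral_congr_fun measurableSet_Ioi h,
    MeasureTheory.integral_neg, integral_exp_mul_Ioi (by linarith)]
  simp

/-- Frullani's integral: both sides have derivative `-1/x` and vanish at `1`. -/
theorem logGammaDeriv_zero {x : ℝ} (hx : 0 < x) : logGammaDeriv 0 0 x = -Real.log x := by
  have hd : ∀ y ∈ Set.Ioi (0 : ℝ),
      HasDerivWithinAt (fun y => logGammaDeriv 0 0 y + Real.log y) 0 (Set.Ioi 0) y := by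
    intro y hy
    have := (hasDerivAt_logGammaDeriv 0 0 hy).add (Real.hasDerivAt_log (ne_of_gt hy))
    rw [zero_add, logGammaDeriv_zero_one hy, neg_add_cancel] at this
    exact this.hasDerivWithinAt
  have := (convex_Ioi (0 : ℝ)).norm_image_sub_le_of_norm_hasDerivWithin_le (C := 0) hd
    (fun y _ => by simp) (Set.mem_Ioi.2 one_pos) (Set.mem_Ioi.2 hx)
  simp only [logGammaDeriv_one, Real.log_one, add_zero, sub_zero, zero_mul, norm_le_zero_iff] at this
  linarith

/-- Bohr–Mollerup: the second derivative of the integral is nonnegative, and the level `0` integral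
is `-log`. -/
theorem exp_logGammaDeriv_one {x : ℝ} (hx : 0 < x) :
    Real.exp (logGammaDeriv 1 0 x) = Real.Gamma x := by
  refine Real.eq_Gamma_of_log_convex (f := fun x => Real.exp (logGammaDeriv 1 0 x)) ?_ ?_
    (fun _ => Real.exp_pos _) (by simp [logGammaDeriv_one]) hx
  · have : Real.log ∘ (fun x => Real.exp (logGammaDeriv 1 0 x)) = logGammaDeriv 1 0 := by
      ext; simp
    rw [this]
    refine convexOn_of_hasDerivWithinAt2_nonneg (convex_Ioi 0)
      (f' := logGammaDeriv 1 1) (f'' := logGammaDeriv 1 2)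
      (contDiffOn_logGammaDeriv 1 0).continuousOn ?_ ?_ ?_
    · exact fun x hx => (hasDerivAt_logGammaDeriv 1 0 (by simpa using hx)).hasDerivWithinAt
    · exact fun x hx => (hasDerivAt_logGammaDeriv 1 1 (by simpa using hx)).hasDerivWithinAt
    · intro x _
      simpa using logGammaDeriv_top_nonneg 1 x
  · intro y hy
    have := logGammaDeriv_sub 0 hy
    rw [logGammaDeriv_zero hy] at this
    rw [show logGammaDeriv 1 0 (y + 1) = Real.log y + logGammaDeriv 1 0 y by linarith,
      Real.exp_add, Real.exp_log hy]

theorem isMultipleGamma_exp_logGammaDeriv :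
    IsMultipleGamma fun n x => Real.exp (logGammaDeriv n 0 x) where
  pos _ _ _ _ := Real.exp_pos _
  contDiffOn n _ := (contDiffOn_logGammaDeriv n (n + 1)).exp
  one_eq_Gamma _ hx := exp_logGammaDeriv_one hx
  recurrence n _ x hx := by
    rw [← Real.exp_sub, ← logGammaDeriv_sub n hx, sub_sub_cancel]
  at_one n _ := by rw [logGammaDeriv_one, Real.exp_zero]
  convexity n _ x hx := by
    simp only [Real.log_exp]
    rw [show (fun t => logGammaDeriv n 0 t) = logGammaDeriv n 0 from rfl,
      iteratedDeriv_logGammaDeriv n _ hx]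
    exact logGammaDeriv_top_nonneg n x

/-! ### Uniqueness for the difference equation -/

theorem hasDerivAt_iteratedDeriv_of_contDiffOn {f : ℝ → ℝ} {s : Set ℝ} (hs : IsOpen s) {k i : ℕ}
    (hf : ContDiffOn ℝ k f s) (hi : i < k) {x : ℝ} (hx : x ∈ s) :
    HasDerivAt (iteratedDeriv i f) (iteratedDeriv (i + 1) f x) x := by
  rw [iteratedDeriv_succ]
  refine DifferentiableAt.hasDerivAt ?_
  have h := (hf.differentiableOn_iteratedDerivWithin (m := i) (by exact_mod_cast hi)
    hs.uniqueDiffOn).congr fun y hy => (iteratedDerivWithin_of_isOpen hs hy).symm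
  exact (h x hx).differentiableAt (hs.mem_nhds hx)

/-- A periodic function on the half line one of whose derivatives is constant is constant. -/
theorem eq_of_periodic_of_iteratedDeriv_const (k : ℕ) :
    ∀ d : ℝ → ℝ, ContDiffOn ℝ k d (Set.Ioi 0) → (∀ x, 0 < x → d (x + 1) = d x) →
      (∀ x, 0 < x → iteratedDeriv k d x = iteratedDeriv k d 1) → ∀ x, 0 < x → d x = d 1 := by
  induction k with
  | zero => intro d _ _ h x hx; simpa using h x hx
  | succ k ih =>
    intro d hd hp h x hx
    have hdiff : ∀ x, 0 < x → DifferentiableAt ℝ d x := fun x hx =>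
      (hd.contDiffAt (isOpen_Ioi.mem_nhds hx)).differentiableAt (by simp)
    push_cast at hd
    have hc := ih (deriv d) ((contDiffOn_succ_iff_deriv_of_isOpen isOpen_Ioi).1 hd).2.2
      (fun x hx => by
        rw [← deriv_comp_add_const]
        refine Filter.EventuallyEq.deriv_eq ?_
        filter_upwards [isOpen_Ioi.mem_nhds hx] with y hy using hp y hy)
      (fun x hx => by simpa only [iteratedDeriv_succ'] using h x hx)
    have hw : ∀ y ∈ Set.Ioi (0 : ℝ),
        HasDerivWithinAt (fun y => d y - deriv d 1 * y) 0 (Set.Ioi 0) y := by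
      intro y hy
      have := (hdiff y hy).hasDerivAt.sub ((hasDerivAt_id y).const_mul (deriv d 1))
      rw [hc y hy, mul_one, sub_self] at this
      exact this.hasDerivWithinAt
    have hconst : ∀ y, 0 < y → d y - deriv d 1 * y = d 1 - deriv d 1 * 1 := by
      intro y hy
      have := (convex_Ioi (0 : ℝ)).norm_image_sub_le_of_norm_hasDerivWithin_le (C := 0) hw
        (fun y _ => by simp) (Set.mem_Ioi.2 one_pos) (Set.mem_Ioi.2 hy)
      simpa [sub_eq_zero] using this
    -- By induction `d` is affine; periodicity kills the slope.
    have h2 := hconst (1 + 1) (by norm_num)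
    rw [hp 1 one_pos] at h2
    have h0 : deriv d 1 = 0 := by linarith
    have := hconst x hx
    rw [h0] at this
    linarith

theorem iteratedDeriv_add_one_sub {f h : ℝ → ℝ} {k : ℕ} (hf : ContDiffOn ℝ k f (Set.Ioi 0))
    (hr : ∀ x, 0 < x → f x - f (x + 1) = h x) {x : ℝ} (hx : 0 < x) :
    iteratedDeriv k f x - iteratedDeriv k f (x + 1) = iteratedDeriv k h x := by
  have hx1 : 0 < x + 1 := by linarith
  have h1 : iteratedDeriv k h x = iteratedDeriv k (f - fun z => f (z + 1)) x := by
    refine Filter.EventuallyEq.iteratedDeriv_eq k ?_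
    filter_upwards [isOpen_Ioi.mem_nhds hx] with y hy using (hr y hy).symm
  have hc : ContDiffAt ℝ k (fun z => f (z + 1)) x :=
    ContDiffAt.comp x (hf.contDiffAt (isOpen_Ioi.mem_nhds hx1)) (by fun_prop)
  rw [h1, iteratedDeriv_sub (hf.contDiffAt (isOpen_Ioi.mem_nhds hx)) hc,
    iteratedDeriv_comp_add_const]

/-- Two solutions of a difference equation that are convex of order `k + 1` differ by a constant. -/
theorem eq_of_sub_add_one_eq {f g h : ℝ → ℝ} {k : ℕ} {σ : ℝ} (hσ : σ ≠ 0)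
    (hf : ContDiffOn ℝ (k + 1 : ℕ) f (Set.Ioi 0)) (hg : ContDiffOn ℝ (k + 1 : ℕ) g (Set.Ioi 0))
    (hfr : ∀ x, 0 < x → f x - f (x + 1) = h x) (hgr : ∀ x, 0 < x → g x - g (x + 1) = h x)
    (hfc : ∀ x, 0 < x → 0 ≤ σ * iteratedDeriv (k + 1) f x)
    (hgc : ∀ x, 0 < x → 0 ≤ σ * iteratedDeriv (k + 1) g x)
    (hlim : ∀ x, 0 < x →
      Filter.Tendsto (fun m : ℕ => iteratedDeriv k h (x + m)) Filter.atTop (nhds 0))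
    (h1 : f 1 = g 1) {x : ℝ} (hx : 0 < x) : f x = g x := by
  have mono : ∀ φ : ℝ → ℝ, ContDiffOn ℝ (k + 1 : ℕ) φ (Set.Ioi 0) →
      (∀ x, 0 < x → 0 ≤ σ * iteratedDeriv (k + 1) φ x) →
      MonotoneOn (fun x => σ * iteratedDeriv k φ x) (Set.Ioi 0) := by
    intro φ hφ hc
    have hd : ∀ x ∈ Set.Ioi (0 : ℝ), HasDerivAt (fun x => σ * iteratedDeriv k φ x)
        (σ * iteratedDeriv (k + 1) φ x) x := fun x hx =>
      (hasDerivAt_iteratedDeriv_of_contDiffOn isOpen_Ioi hφ (Nat.lt_succ_self k) hx).const_mul σ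
    refine monotoneOn_of_hasDerivWithinAt_nonneg (convex_Ioi 0)
      (fun x hx => (hd x hx).continuousAt.continuousWithinAt)
      (fun x hx => (hd x (by simpa using hx)).hasDerivWithinAt) fun x hx => hc x (by simpa using hx)
  have hmf := mono f hf hfc
  have hmg := mono g hg hgc
  have hle : ((k : ℕ) : WithTop ℕ∞) ≤ ((k + 1 : ℕ) : WithTop ℕ∞) := by exact_mod_cast k.le_succ
  have hf' := hf.of_le hle
  have hg' := hg.of_le hle
  set p : ℝ → ℝ := fun x => σ * iteratedDeriv k f x - σ * iteratedDeriv k g x with hp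
  have hper : ∀ x, 0 < x → p (x + 1) = p x := by
    intro x hx
    have e1 := iteratedDeriv_add_one_sub hf' hfr hx
    have e2 := iteratedDeriv_add_one_sub hg' hgr hx
    simp only [hp]
    linear_combination σ * (e2 - e1)
  have hperm : ∀ (m : ℕ) x, 0 < x → p (x + m) = p x := by
    intro m
    induction m with
    | zero => simp
    | succ m ih =>
      intro x hx
      push_cast
      rw [← add_assoc, hper _ (by positivity), ih x hx]
  -- On `[x, x + 1]` both scaled derivatives are monotone with the same total increment `-σ
  -- h⁽ᵏ⁾(x)`, so their difference moves by no more than that.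
  have hnear : ∀ x y, 0 < x → x ≤ y → y ≤ x + 1 → |p y - p x| ≤ |σ * iteratedDeriv k h x| := by
    intro x y hx hxy hyx
    have hy : 0 < y := hx.trans_le hxy
    have hx1 : 0 < x + 1 := by linarith
    have e1 := iteratedDeriv_add_one_sub hf' hfr hx
    have e2 := iteratedDeriv_add_one_sub hg' hgr hx
    have a1 := hmf hx hy hxy
    have a2 := hmf hy hx1 hyx
    have b1 := hmg hx hy hxy
    have b2 := hmg hy hx1 hyx
    have e1' : σ * iteratedDeriv k f x - σ * iteratedDeriv k f (x + 1) =
      σ * iteratedDeriv k h x := by rw [← e1]; ring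
    have e2' : σ * iteratedDeriv k g x - σ * iteratedDeriv k g (x + 1) =
      σ * iteratedDeriv k h x := by rw [← e2]; ring
    simp only [hp] at *
    refine (abs_le.2 ⟨?_, ?_⟩).trans (neg_le_abs _) <;> linarith
  -- Translating by `m` leaves `p` unchanged while the bound tends to `0`.
  have hloc : ∀ x y, 0 < x → x ≤ y → y ≤ x + 1 → p y = p x := by
    intro x y hx hxy hyx
    have ht : Filter.Tendsto (fun m : ℕ => |σ * iteratedDeriv k h (x + m)|) Filter.atTop
        (nhds 0) := by
      simpa using ((hlim x hx).const_mul σ).abs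
    have := ge_of_tendsto' (b := |p y - p x|) ht fun m => by
      have := hnear (x + m) (y + m) (by positivity) (by linarith) (by linarith)
      rwa [hperm m x hx, hperm m y (hx.trans_le hxy)] at this
    exact sub_eq_zero.1 (abs_eq_zero.1 (le_antisymm this (abs_nonneg _)))
  have hpc : ∀ x, 0 < x → p x = p 1 := by
    intro x hx
    rcases le_total x 1 with h | h
    · exact (hloc x 1 hx h (by linarith)).symm
    · have hx1 : (⌊x⌋₊ : ℝ) ≤ x := Nat.floor_le hx.le
      have hx2 := Nat.lt_floor_add_one x
      have hx3 : 1 ≤ ⌊x⌋₊ := Nat.one_le_floor_iff _ |>.2 h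
      have hx4 : (0 : ℝ) < ⌊x⌋₊ := by exact_mod_cast hx3
      rw [hloc ⌊x⌋₊ x hx4 hx1 hx2.le]
      have := hperm (⌊x⌋₊ - 1) 1 one_pos
      rwa [Nat.cast_sub hx3, Nat.cast_one, add_sub_cancel] at this
  have hd : ∀ y, 0 < y → iteratedDeriv k (f - g) y = σ⁻¹ * p y := by
    intro y hy
    rw [iteratedDeriv_sub (hf'.contDiffAt (isOpen_Ioi.mem_nhds hy))
      (hg'.contDiffAt (isOpen_Ioi.mem_nhds hy)), hp]
    field_simp
  have := eq_of_periodic_of_iteratedDeriv_const k (f - g) (hf'.sub hg')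
    (fun y hy => by
      have e1 := hfr y hy
      have e2 := hgr y hy
      simp only [Pi.sub_apply]
      linarith)
    (fun y hy => by rw [hd y hy, hd 1 one_pos, hpc y hy]) x hx
  simp only [Pi.sub_apply, h1, sub_self] at this
  linarith

/-- Level by level, both sides solve one difference equation, whose right side is the previous
level; its derivative of order `n + 1` decays along `x + m`. -/
theorem IsMultipleGamma.log_eq {Γ : ℕ → ℝ → ℝ} (hΓ : IsMultipleGamma Γ) {n : ℕ} (hn : 1 ≤ n) :
    ∀ x, 0 < x → Real.log (Γ n x) = logGammaDeriv n 0 x := by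
  induction n, hn using Nat.le_induction with
  | base =>
    intro x hx
    rw [hΓ.one_eq_Gamma x hx, ← exp_logGammaDeriv_one hx, Real.log_exp]
  | succ n hn ih =>
    intro x hx
    have hn1 : 1 ≤ n + 1 := by omega
    refine eq_of_sub_add_one_eq (f := fun t => Real.log (Γ (n + 1) t)) (g := logGammaDeriv (n + 1) 0)
      (h := logGammaDeriv n 0) (k := n + 1) (σ := (-1) ^ (n + 1 + 1)) (by simp) ?_
      (contDiffOn_logGammaDeriv _ _) ?_ (fun x hx => logGammaDeriv_sub n hx)
      (hΓ.convexity (n + 1) hn1) ?_ ?_ ?_ hx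
    · exact (hΓ.contDiffOn (n + 1) hn1).log fun x hx => (hΓ.pos _ hn1 x hx).ne'
    · intro x hx
      rw [hΓ.recurrence n hn x hx, Real.log_div (hΓ.pos _ hn1 x hx).ne' (hΓ.pos _ hn x hx).ne',
        ih x hx, sub_sub_cancel]
    · intro x hx
      rw [iteratedDeriv_logGammaDeriv _ _ hx]
      exact logGammaDeriv_top_nonneg _ _
    · intro x hx
      refine (tendsto_logGammaDeriv_top n hx).congr fun m => ?_
      rw [iteratedDeriv_logGammaDeriv _ _ (by positivity)]
    · simp [hΓ.at_one (n + 1) hn1, logGammaDeriv_one]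

/-! ### Dirichlet series and exponential expansions -/

theorem hasSum_one_div_nat_add_one_cpow {w : ℂ} (hw : 1 < w.re) :
    HasSum (fun m : ℕ => 1 / (((m : ℝ) + 1 : ℝ) : ℂ) ^ w) (riemannZeta w) := by
  have h := (summable_nat_add_iff 1).2 (Complex.summable_one_div_nat_cpow.2 hw)
  rw [zeta_eq_tsum_one_div_nat_add_one_cpow hw]
  simpa using h.hasSum

/-- The even integers contribute `2 ^ (-w) ζ(w)` to `ζ(w)`; the odd ones, rescaled by `2 ^ w`, are
the half-integers. -/
theorem hasSum_one_div_nat_add_half_cpow {w : ℂ} (hw : 1 < w.re) :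
    HasSum (fun m : ℕ => 1 / (((m : ℝ) + 1 / 2 : ℝ) : ℂ) ^ w) ((2 ^ w - 1) * riemannZeta w) := by
  have h := hasSum_one_div_nat_add_one_cpow hw
  have h2w : (2 : ℂ) ^ w ≠ 0 := by simp
  have hodd : HasSum (fun m : ℕ => 1 / ((((2 * m + 1 : ℕ) : ℝ) + 1 : ℝ) : ℂ) ^ w)
      ((2 ^ w)⁻¹ * riemannZeta w) := by
    refine (h.mul_left ((2 : ℂ) ^ w)⁻¹).congr_fun fun m => ?_
    rw [show (((2 * m + 1 : ℕ) : ℝ) + 1 : ℝ) = 2 * ((m : ℝ) + 1) by push_cast; ring,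
      Complex.ofReal_mul, Complex.mul_cpow_ofReal_nonneg (by norm_num) (by positivity),
      Complex.ofReal_ofNat]
    field_simp
  have hsum : Summable fun m : ℕ => 1 / ((((2 * m : ℕ) : ℝ) + 1 : ℝ) : ℂ) ^ w :=
    h.summable.comp_injective (i := fun m : ℕ => 2 * m) (mul_right_injective₀ two_ne_zero)
  obtain ⟨E, heven⟩ := hsum
  have htot := (HasSum.even_add_odd (f := fun m : ℕ => 1 / (((m : ℝ) + 1 : ℝ) : ℂ) ^ w)
    heven hodd).unique h
  have hE : 2 ^ w * E = (2 ^ w - 1) * riemannZeta w := by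
    rw [eq_sub_of_add_eq htot]
    field_simp
  rw [← hE]
  refine (heven.mul_left ((2 : ℂ) ^ w)).congr_fun fun m => ?_
  rw [show (((2 * m : ℕ) : ℝ) + 1 : ℝ) = 2 * ((m : ℝ) + 1 / 2) by push_cast; ring,
    Complex.ofReal_mul, Complex.mul_cpow_ofReal_nonneg (by norm_num) (by positivity),
    Complex.ofReal_ofNat]
  field_simp

theorem hasSum_eval_div_cpow {P : Polynomial ℝ} {N : ℕ} (hP : P.natDegree ≤ N) {θ : ℝ} (hθ : 0 < θ)
    {Z : ℂ → ℂ}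
    (hZ : ∀ w : ℂ, 1 < w.re → HasSum (fun m : ℕ => 1 / (((m : ℝ) + θ : ℝ) : ℂ) ^ w) (Z w))
    {s : ℂ} (hs : (N : ℝ) + 1 < s.re) :
    HasSum (fun m : ℕ => ((P.eval ((m : ℝ) + θ) : ℝ) : ℂ) / (((m : ℝ) + θ : ℝ) : ℂ) ^ s)
      (∑ k ∈ Finset.range (N + 1), (P.coeff k : ℂ) * Z (s - k)) := by
  have h := hasSum_sum (s := Finset.range (N + 1)) fun k hk =>
    (hZ (s - k) (by
      have : (k : ℝ) ≤ N := by exact_mod_cast Nat.lt_succ_iff.1 (Finset.mem_range.1 hk)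
      simp only [Complex.sub_re, Complex.natCast_re]
      linarith)).mul_left (P.coeff k : ℂ)
  refine h.congr_fun fun m => ?_
  have hm : (((m : ℝ) + θ : ℝ) : ℂ) ≠ 0 := by
    exact_mod_cast (by positivity : (m : ℝ) + θ ≠ 0)
  rw [Polynomial.eval_eq_sum_range' (Nat.lt_succ_of_le hP), Complex.ofReal_sum, Finset.sum_div]
  refine Finset.sum_congr rfl fun k _ => ?_
  rw [Complex.cpow_sub _ _ hm, Complex.cpow_natCast]
  push_cast
  field_simp

theorem hasSum_choose_mul_exp (r : ℕ) {t : ℝ} (ht : 0 < t) :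
    HasSum (fun m : ℕ => ((m + r).choose r : ℝ) * Real.exp (-t) ^ m)
      (1 / (1 - Real.exp (-t)) ^ (r + 1)) :=
  hasSum_choose_mul_geometric_of_norm_lt_one r (by simpa using ht)

theorem choose_eq_prod (N m : ℕ) :
    ((m + N).choose N : ℝ) = (∏ j ∈ Finset.Icc 1 N, ((m : ℝ) + j)) / N.factorial := by
  have h := sum_shiftedChoose_mul_choose 1 N m
  rw [Finset.sum_range_succ'] at h
  simp only [eval_shiftedChoose_succ_one, shiftedChoose_zero] at h
  simp only [mul_zero, zero_mul, Finset.sum_const_zero, zero_add, pow_zero, Polynomial.eval_one,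
    mul_one, one_mul, tsub_zero] at h
  rw [h]
  congr 1
  refine Finset.prod_congr rfl fun j _ => by ring

/-- The polynomial whose coefficients are `multipleGammaCoeff`. -/
noncomputable def multipleGammaPoly (N : ℕ) (z : ℝ) : Polynomial ℝ :=
  ∏ j ∈ Finset.Icc 1 N, (Polynomial.X + Polynomial.C ((j : ℝ) - z))

theorem natDegree_multipleGammaPoly_le (N : ℕ) (z : ℝ) : (multipleGammaPoly N z).natDegree ≤ N := by
  refine (Polynomial.natDegree_prod_le _ _).trans ?_
  refine (Finset.sum_le_sum fun i _ => (Polynomial.natDegree_X_add_C _).le).trans ?_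
  simp

theorem eval_multipleGammaPoly (N : ℕ) (z x : ℝ) :
    (multipleGammaPoly N z).eval x = ∏ j ∈ Finset.Icc 1 N, (x + (j - z)) := by
  simp [multipleGammaPoly, Polynomial.eval_prod]

theorem hasSum_exp_div_pow (N : ℕ) (z : ℝ) {t : ℝ} (ht : 0 < t) :
    HasSum (fun m : ℕ => (multipleGammaPoly N z).eval ((m : ℝ) + z) / N.factorial *
      Real.exp (-((m : ℝ) + z) * t)) (Real.exp (-z * t) / (1 - Real.exp (-t)) ^ (N + 1)) := by
  rw [← mul_one_div]
  refine ((hasSum_choose_mul_exp N ht).mul_left (Real.exp (-z * t))).congr_fun fun m => ?_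
  rw [choose_eq_prod, eval_multipleGammaPoly, ← Real.exp_nat_mul,
    show -((m : ℝ) + z) * t = -z * t + m * -t by ring, Real.exp_add]
  simp only [add_add_sub_cancel]
  ring

/-- Powers of `u` cancel and negative binomial series remain; by `sum_shiftedChoose_mul_choose`
their coefficients combine into the same polynomial as in `hasSum_exp_div_pow`, sampled at integers.
-/
theorem hasSum_newtonPoly_div_pow (N : ℕ) (z : ℝ) {t : ℝ} (ht : 0 < t) :
    HasSum (fun m : ℕ => (multipleGammaPoly N z).eval ((m : ℝ) + 1) / N.factorial *
      Real.exp (-((m : ℝ) + 1) * t))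
      (Real.exp (-t) * (newtonPoly N (1 - Real.exp (-t))).eval z /
        (1 - Real.exp (-t)) ^ (N + 1)) := by
  have hu := one_sub_exp_neg_pos ht
  have h := (hasSum_sum (s := Finset.range (N + 1)) fun j _ =>
    (hasSum_choose_mul_exp (N - j) ht).mul_left ((-1) ^ j * (shiftedChoose j).eval z)).mul_left
      (Real.exp (-t))
  have e : Real.exp (-t) * (newtonPoly N (1 - Real.exp (-t))).eval z /
      (1 - Real.exp (-t)) ^ (N + 1) = Real.exp (-t) * ∑ j ∈ Finset.range (N + 1),
        (-1) ^ j * (shiftedChoose j).eval z * (1 / (1 - Real.exp (-t)) ^ (N - j + 1)) := by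
    rw [mul_div_assoc, eval_newtonPoly, Finset.sum_div]
    congr 1
    refine Finset.sum_congr rfl fun j hj => ?_
    rw [Finset.mem_range] at hj
    rw [show N + 1 = j + (N - j + 1) by omega, pow_add, neg_pow]
    field_simp
  rw [e]
  refine h.congr_fun fun m => ?_
  rw [eval_multipleGammaPoly, ← sum_shiftedChoose_mul_choose, ← Real.exp_nat_mul,
    show -((m : ℝ) + 1) * t = -t + m * -t by ring, Real.exp_add, Finset.sum_mul, Finset.mul_sum]
  exact Finset.sum_congr rfl fun j _ => by ring

/-- The top Newton term carries the full power of `u`, so it cancels the denominator and leaves a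
lone `exp (-t)`. -/
theorem mul_logGammaKernel (N : ℕ) (z : ℝ) {t : ℝ} (ht : 0 < t) :
    t * logGammaKernel (N + 1) 0 z t =
      Real.exp (-z * t) / (1 - Real.exp (-t)) ^ (N + 1) -
      Real.exp (-t) * (newtonPoly N (1 - Real.exp (-t))).eval z / (1 - Real.exp (-t)) ^ (N + 1) -
      (-1) ^ (N + 1) * (shiftedChoose (N + 1)).eval z * Real.exp (-t) := by
  have hu := one_sub_exp_neg_pos ht
  have hQ : (newtonPoly (N + 1) (1 - Real.exp (-t))).eval z =
      (newtonPoly N (1 - Real.exp (-t))).eval z +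
        (-(1 - Real.exp (-t))) ^ (N + 1) * (shiftedChoose (N + 1)).eval z := by
    rw [eval_newtonPoly, eval_newtonPoly, Finset.sum_range_succ]
  simp only [logGammaKernel, Function.iterate_zero, id, pow_zero, one_mul]
  rw [hQ, neg_pow (1 - Real.exp (-t))]
  field_simp
  ring

/-! ### Mellin transform and analytic continuation -/

/-- The function whose Mellin transform at `0` is `log Γ_{N+1}(z)`. -/
noncomputable def mellinKernel (N : ℕ) (z t : ℝ) : ℂ :=
  ((t * logGammaKernel (N + 1) 0 z t : ℝ) : ℂ)

theorem mellin_mellinKernel_zero (N : ℕ) (z : ℝ) :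
    mellin (mellinKernel N z) 0 = (logGammaDeriv (N + 1) 0 z : ℂ) := by
  rw [mellin, logGammaDeriv, ← integral_complex_ofReal]
  refine MeasureTheory.setIntegral_congr_fun measurableSet_Ioi fun t ht => ?_
  have : (t : ℂ) ≠ 0 := by exact_mod_cast (ne_of_gt ht)
  simp only [zero_sub, Complex.cpow_neg_one, mellinKernel, smul_eq_mul]
  push_cast
  field_simp

/-- The extra factor `t` makes the kernel `O(t)` at `0`, so `s = 0` is interior to the domain of
holomorphy. -/
theorem differentiableAt_mellin_mellinKernel (N : ℕ) {z : ℝ} (hz : 0 < z) {s : ℂ} (hs : -1 < s.re) :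
    DifferentiableAt ℂ (mellin (mellinKernel N z)) s := by
  obtain ⟨C, hC, δ, hδ, h⟩ := exists_abs_logGammaKernel_le (N + 1) 0 hz z
  obtain ⟨C', hC', h'⟩ := one_add_pow_mul_exp_le 1 hδ
  have hbd : ∀ t, 0 < t → ‖mellinKernel N z t‖ ≤ t * (C * Real.exp (-δ * t)) := by
    intro t ht
    rw [mellinKernel, Complex.norm_real, Real.norm_eq_abs, abs_mul, abs_of_pos ht]
    exact mul_le_mul_of_nonneg_left (h t ht z ⟨le_rfl, le_rfl⟩) ht.le
  refine mellin_differentiableAt_of_isBigO_rpow_exp (a := δ / 2) (b := -1) (by positivity) ?_ ?_ ?_ hs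
  · refine ContinuousOn.locallyIntegrableOn ?_ measurableSet_Ioi
    exact Complex.continuous_ofReal.comp_continuousOn
      (continuousOn_id.mul (continuousOn_logGammaKernel _ _ _))
  · refine Asymptotics.IsBigO.of_bound (C * C') ?_
    filter_upwards [Filter.eventually_gt_atTop 0] with t ht
    rw [Real.norm_eq_abs, Real.abs_exp]
    calc _ ≤ t * (C * Real.exp (-δ * t)) := hbd t ht
      _ ≤ C * ((1 + t) ^ 1 * Real.exp (-δ * t)) := by
        have : 0 ≤ C * Real.exp (-δ * t) := by positivity
        linarith
      _ ≤ C * (C' * Real.exp (-(δ / 2) * t)) := mul_le_mul_of_nonneg_left (h' t ht) hC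
      _ = _ := by ring
  · refine Asymptotics.IsBigO.of_bound C ?_
    filter_upwards [self_mem_nhdsWithin] with t ht
    have ht' : 0 < t := ht
    rw [neg_neg, Real.rpow_one, Real.norm_eq_abs, abs_of_pos ht']
    calc _ ≤ t * (C * Real.exp (-δ * t)) := hbd t ht
      _ ≤ t * (C * 1) := by
        gcongr
        exact Real.exp_le_one_iff.2 (by nlinarith)
      _ = _ := by ring

/-- The Dirichlet series side of the Mellin transform at `z = 1/2`. -/
noncomputable def halfZetaSum (N : ℕ) (s : ℂ) : ℂ :=
  (N.factorial : ℂ)⁻¹ * ∑ k ∈ Finset.range (N + 1),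
    ((multipleGammaPoly N (1 / 2)).coeff k : ℂ) * ((2 ^ (s - k) - 2) * riemannZeta (s - k)) -
  (((-1) ^ (N + 1) * (shiftedChoose (N + 1)).eval (1 / 2) : ℝ) : ℂ)

theorem mellin_mellinKernel_half (N : ℕ) {s : ℂ} (hs : (N : ℝ) + 1 < s.re) :
    mellin (mellinKernel N (1 / 2)) s = Complex.Gamma s * halfZetaSum N s := by
  set c : ℝ := (-1) ^ (N + 1) * (shiftedChoose (N + 1)).eval (1 / 2)
  have hs0 : 0 < s.re := by
    have : (0 : ℝ) ≤ N := by positivity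
    linarith
  have hN : (N.factorial : ℂ) ≠ 0 := by exact_mod_cast N.factorial_ne_zero
  have H1 := hasSum_eval_div_cpow (natDegree_multipleGammaPoly_le N (1 / 2)) (θ := 1 / 2)
    (by norm_num) (fun w hw => hasSum_one_div_nat_add_half_cpow hw) hs
  have H2 := hasSum_eval_div_cpow (natDegree_multipleGammaPoly_le N (1 / 2)) (θ := 1)
    (by norm_num) (fun w hw => hasSum_one_div_nat_add_one_cpow hw) hs
  -- Half-integers, integers and the lone exponential share one index type, so a single termwise
  -- Mellin transform suffices.
  let a : (ℕ ⊕ ℕ) ⊕ Unit → ℂ := Sum.elim (Sum.elim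
    (fun m => (((multipleGammaPoly N (1 / 2)).eval ((m : ℝ) + 1 / 2) / N.factorial : ℝ) : ℂ))
    (fun m => ((-((multipleGammaPoly N (1 / 2)).eval ((m : ℝ) + 1) / N.factorial) : ℝ) : ℂ)))
    (fun _ => ((-c : ℝ) : ℂ))
  let p : (ℕ ⊕ ℕ) ⊕ Unit → ℝ := Sum.elim (Sum.elim (fun m => (m : ℝ) + 1 / 2)
    (fun m => (m : ℝ) + 1)) (fun _ => 1)
  have hp : ∀ i, 0 < p i := by
    rintro ((m | m) | m) <;> simp only [p, Sum.elim_inl, Sum.elim_inr] <;> positivity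
  have key : HasSum (fun i => a i / (p i : ℂ) ^ s) (halfZetaSum N s) := by
    have e : halfZetaSum N s = ((N.factorial : ℂ)⁻¹ * ∑ k ∈ Finset.range (N + 1),
        ((multipleGammaPoly N (1 / 2)).coeff k : ℂ) * ((2 ^ (s - k) - 1) * riemannZeta (s - k)) +
        -(N.factorial : ℂ)⁻¹ * ∑ k ∈ Finset.range (N + 1),
        ((multipleGammaPoly N (1 / 2)).coeff k : ℂ) * riemannZeta (s - k)) + ((-c : ℝ) : ℂ) := by
      rw [halfZetaSum, neg_mul, ← sub_eq_add_neg, ← mul_sub, ← Finset.sum_sub_distrib,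
        Complex.ofReal_neg, ← sub_eq_add_neg]
      congr 2
      exact Finset.sum_congr rfl fun k _ => by ring
    rw [e]
    refine HasSum.sum (HasSum.sum ?_ ?_) ?_
    · refine (H1.mul_left _).congr_fun fun m => ?_
      simp only [a, p, Function.comp_apply, Sum.elim_inl]
      push_cast
      field_simp
    · refine (H2.mul_left _).congr_fun fun m => ?_
      simp only [a, p, Function.comp_apply, Sum.elim_inl, Sum.elim_inr]
      push_cast
      field_simp
    · simp [a, p, Function.comp_def]
  have hF : ∀ t ∈ Set.Ioi (0 : ℝ), HasSum (fun i => a i * Real.exp (-p i * t))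
      (mellinKernel N (1 / 2) t) := by
    intro t ht
    have h1 := hasSum_exp_div_pow N (1 / 2) ht
    have h2 := (hasSum_newtonPoly_div_pow N (1 / 2) ht).neg
    rw [mellinKernel, mul_logGammaKernel N _ ht, sub_eq_add_neg, sub_eq_add_neg, Complex.ofReal_add,
      Complex.ofReal_add]
    refine HasSum.sum (HasSum.sum ?_ ?_) ?_
    · refine (Complex.hasSum_ofReal.2 h1).congr_fun fun m => ?_
      simp only [a, p, Function.comp_apply, Sum.elim_inl, ← Complex.ofReal_mul, neg_mul]
    · refine (Complex.hasSum_ofReal.2 h2).congr_fun fun m => ?_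
      simp only [a, p, Function.comp_apply, Sum.elim_inl, Sum.elim_inr, ← Complex.ofReal_mul, neg_mul]
    · convert hasSum_unique (fun _ : Unit => ((-c : ℝ) : ℂ) * Real.exp (-1 * t)) using 1
      · ext x
        simp [a, p]
      · simp [c]
  have := hasSum_mellin (fun i => Or.inr (hp i)) hs0 hF (key.summable.norm.congr fun i => by
    rw [norm_div, Complex.norm_cpow_eq_rpow_re_of_pos (hp i)])
  refine this.unique ((key.mul_left (Complex.Gamma s)).congr_fun fun i => ?_)
  rw [mul_div_assoc]

/-- The poles of `ζ(s - k)` lie on the removed ray `[1, ∞)`, and what is left is star-shaped about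
`0`. -/
theorem isPreconnected_re_gt_neg_one_slit :
    IsPreconnected {s : ℂ | -1 < s.re ∧ (s.re < 1 ∨ s.im ≠ 0)} := by
  refine (StarConvex.isPathConnected (a := 0) ?_ (by simp)).isConnected.isPreconnected
  rw [starConvex_zero_iff]
  rintro s ⟨h1, h2⟩ a ha0 ha1
  simp only [Set.mem_ofPred_eq, Complex.real_smul, Complex.re_ofReal_mul, Complex.im_ofReal_mul]
  rcases ha0.eq_or_lt with rfl | ha0
  · simp
  refine ⟨by nlinarith, h2.imp (fun h => ?_) (mul_ne_zero ha0.ne')⟩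
  rcases le_or_gt s.re 0 with h | h <;> nlinarith

theorem isOpen_re_gt_neg_one_slit : IsOpen {s : ℂ | -1 < s.re ∧ (s.re < 1 ∨ s.im ≠ 0)} :=
  (isOpen_lt continuous_const Complex.continuous_re).inter
    ((isOpen_lt Complex.continuous_re continuous_const).union
      (isOpen_ne_fun Complex.continuous_im continuous_const))

theorem hasDerivAt_halfZetaSum (N : ℕ) {s : ℂ} (hs : ∀ k : ℕ, s - k ≠ 1) :
    HasDerivAt (halfZetaSum N) ((N.factorial : ℂ)⁻¹ * ∑ k ∈ Finset.range (N + 1),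
      ((multipleGammaPoly N (1 / 2)).coeff k : ℂ) * (2 ^ (s - k) * (Real.log 2 : ℂ) *
        riemannZeta (s - k) + (2 ^ (s - k) - 2) * deriv riemannZeta (s - k))) s := by
  unfold halfZetaSum
  refine HasDerivAt.sub_const _ (HasDerivAt.const_mul _ (HasDerivAt.fun_sum fun k _ =>
    HasDerivAt.const_mul _ ?_))
  have hid : HasDerivAt (fun s : ℂ => s - k) 1 s := (hasDerivAt_id s).sub_const _
  have h1 : HasDerivAt (fun s : ℂ => (2 : ℂ) ^ (s - k) - 2) (2 ^ (s - k) * (Real.log 2 : ℂ)) s := by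
    have := (hid.const_cpow (c := 2) (Or.inl two_ne_zero)).sub_const 2
    rwa [mul_one, ← Complex.ofReal_ofNat, ← Complex.ofReal_log (by norm_num)] at this
  have h2 : HasDerivAt (fun s : ℂ => riemannZeta (s - k)) (deriv riemannZeta (s - k)) s := by
    have := (differentiableAt_riemannZeta (hs k)).hasDerivAt.comp s hid
    rwa [mul_one] at this
  exact h1.mul h2

theorem eqOn_inv_Gamma_mul_mellin (N : ℕ) :
    Set.EqOn (fun s => (Complex.Gamma s)⁻¹ * mellin (mellinKernel N (1 / 2)) s) (halfZetaSum N)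
      {s : ℂ | -1 < s.re ∧ (s.re < 1 ∨ s.im ≠ 0)} := by
  have hO := isOpen_re_gt_neg_one_slit
  -- The base point lies in the half-plane of convergence; `I` moves it off the removed ray.
  refine AnalyticOnNhd.eqOn_of_preconnected_of_eventuallyEq (z₀ := ((N + 2 : ℕ) : ℂ) + Complex.I)
    (DifferentiableOn.analyticOnNhd ?_ hO) (DifferentiableOn.analyticOnNhd ?_ hO)
    isPreconnected_re_gt_neg_one_slit ⟨?_, Or.inr ?_⟩ ?_
  · intro s hs
    exact ((Complex.differentiable_one_div_Gamma s).mul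
      (differentiableAt_mellin_mellinKernel N (by norm_num) hs.1)).differentiableWithinAt
  · intro s hs
    refine (hasDerivAt_halfZetaSum N fun k hk => ?_).differentiableAt.differentiableWithinAt
    rw [sub_eq_iff_eq_add] at hk
    rcases hs.2 with h | h
    · rw [hk] at h
      simp only [Complex.add_re, Complex.one_re, Complex.natCast_re] at h
      have : (0 : ℝ) ≤ k := by positivity
      linarith
    · exact h (by simp [hk])
  · simp only [Complex.add_re, Complex.natCast_re, Complex.I_re]
    have : (0 : ℝ) ≤ (N + 2 : ℕ) := by positivity
    linarith
  · simp
  · have ho : IsOpen {s : ℂ | (N : ℝ) + 1 < s.re} := isOpen_lt continuous_const Complex.continuous_re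
    filter_upwards [ho.mem_nhds (x := ((N + 2 : ℕ) : ℂ) + Complex.I) (by simp)] with s hs
    have hs' : (N : ℝ) + 1 < s.re := hs
    have : Complex.Gamma s ≠ 0 := Complex.Gamma_ne_zero_of_re_pos (by
      have : (0 : ℝ) ≤ N := by positivity
      linarith)
    rw [mellin_mellinKernel_half N hs']
    field_simp

/-! ### The closed form at one half -/

theorem hasDerivAt_inv_Gamma_zero : HasDerivAt (fun s : ℂ => (Complex.Gamma s)⁻¹) 1 0 := by
  rw [funext Complex.one_div_Gamma_eq_self_mul_one_div_Gamma_add_one]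
  have h : DifferentiableAt ℂ (fun s : ℂ => (Complex.Gamma (s + 1))⁻¹) 0 :=
    (Complex.differentiable_one_div_Gamma.comp (differentiable_id.add_const (1 : ℂ))) 0
  simpa using (hasDerivAt_id (0 : ℂ)).fun_mul h.hasDerivAt

/-- In the product rule at `0` only the Mellin transform's value survives, and the constant in
`halfZetaSum` drops out. -/
theorem logGammaDeriv_half (N : ℕ) :
    (N.factorial : ℂ) * (logGammaDeriv (N + 1) 0 (1 / 2) : ℂ) = ∑ k ∈ Finset.range (N + 1),
      ((multipleGammaPoly N (1 / 2)).coeff k : ℂ) * ((2 ^ k)⁻¹ * (Real.log 2 : ℂ) *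
        riemannZeta (-k) + ((2 ^ k)⁻¹ - 2) * deriv riemannZeta (-k)) := by
  have h1 := hasDerivAt_halfZetaSum N (s := 0) fun k hk => by
    have := congrArg Complex.re hk
    simp only [zero_sub, Complex.neg_re, Complex.natCast_re, Complex.one_re] at this
    have : (0 : ℝ) ≤ k := by positivity
    linarith
  have h2 := hasDerivAt_inv_Gamma_zero.mul
    (differentiableAt_mellin_mellinKernel N (z := 1 / 2) (by norm_num) (s := 0) (by simp)).hasDerivAt
  have h3 := h2.congr_of_eventuallyEq ((eqOn_inv_Gamma_mul_mellin N).symm.eventuallyEq_of_mem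
    (isOpen_re_gt_neg_one_slit.mem_nhds (by simp)))
  have h4 := h1.unique h3
  rw [mellin_mellinKernel_zero, Complex.Gamma_zero, inv_zero, zero_mul, add_zero, one_mul] at h4
  have hN : (N.factorial : ℂ) ≠ 0 := by exact_mod_cast N.factorial_ne_zero
  rw [← h4, mul_inv_cancel_left₀ hN]
  simp only [zero_sub, Complex.cpow_neg, Complex.cpow_natCast]

/-- The case `N = 0` of `logGammaDeriv_half` read backwards, with `Γ(1/2) = √π`. -/
theorem log_two_mul_zeta_zero_sub_deriv :
    (Real.log 2 : ℂ) * riemannZeta 0 - deriv riemannZeta 0 = (Real.log Real.pi : ℂ) / 2 := by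
  have h := logGammaDeriv_half 0
  have hG : logGammaDeriv (0 + 1) 0 (1 / 2) = Real.log Real.pi / 2 := by
    rw [← Real.log_exp (logGammaDeriv (0 + 1) 0 (1 / 2)), zero_add,
      exp_logGammaDeriv_one (by norm_num), Real.Gamma_one_half_eq, Real.log_sqrt Real.pi_pos.le]
  rw [hG] at h
  simp [multipleGammaPoly] at h
  rw [show (Real.log Real.pi : ℂ) / 2 = _ from h]
  norm_num
  ring

open scoped Nat in
theorem coeff_zero_multipleGammaPoly_half (N : ℕ) :
    (multipleGammaPoly N (1 / 2)).coeff 0 = ((2 * (N + 1) - 3)‼ : ℕ) / 2 ^ N := by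
  rw [Polynomial.coeff_zero_eq_eval_zero, eval_multipleGammaPoly]
  induction N with
  | zero => simp
  | succ N ih =>
    rw [Finset.prod_Icc_succ_top (by omega), ih]
    -- For `N = 0` the subtraction `2 * 1 - 3` truncates, so the double factorial recursion does not
    -- apply.
    rcases N with _ | N
    · norm_num
    · rw [show 2 * (N + 1 + 1 + 1) - 3 = 2 * N + 1 + 2 by omega,
        show 2 * (N + 1 + 1) - 3 = 2 * N + 1 by omega, Nat.doubleFactorial_add_two]
      push_cast
      field_simp
      ring

/-- The two Bernoulli conventions differ only at index `1`, which `k ≥ 1` avoids. -/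
theorem riemannZeta_neg_nat_eq_neg_bernoulli {k : ℕ} (hk : 1 ≤ k) :
    riemannZeta (-k) = -(bernoulli (k + 1) : ℂ) / (k + 1) := by
  rw [riemannZeta_neg_nat_eq_bernoulli', bernoulli_eq_bernoulli'_of_ne_one (by omega)]

theorem logGammaDeriv_half_eq (N : ℕ) :
    -(N.factorial : ℂ) * (logGammaDeriv (N + 1) 0 (1 / 2) : ℂ) =
      -(((2 * (N + 1) - 3).doubleFactorial : ℕ) : ℂ) * (Real.log Real.pi : ℂ) / 2 ^ (N + 1)
        + (Real.log 2 : ℂ) * ∑ k ∈ Finset.Icc 1 (N + 1),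
            ((multipleGammaPoly N (1 / 2)).coeff k : ℂ) * (bernoulli (k + 1) : ℂ)
              / (((k : ℂ) + 1) * 2 ^ k)
        + ∑ k ∈ Finset.Icc 1 (N + 1),
            ((2 : ℂ) ^ (k + 1) - 1) / 2 ^ k * ((multipleGammaPoly N (1 / 2)).coeff k : ℂ)
              * deriv riemannZeta (-(k : ℂ)) := by
  -- The stated sums run one index past the degree `N`.
  have htop : (multipleGammaPoly N (1 / 2)).coeff (N + 1) = 0 :=
    Polynomial.coeff_eq_zero_of_natDegree_lt
      (Nat.lt_succ_of_le (natDegree_multipleGammaPoly_le N (1 / 2)))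
  rw [neg_mul, logGammaDeriv_half, Finset.sum_range_eq_add_Ico _ (by omega),
    Finset.sum_Icc_succ_top (by omega), Finset.sum_Icc_succ_top (by omega), htop,
    coeff_zero_multipleGammaPoly_half]
  have hz := log_two_mul_zeta_zero_sub_deriv
  have hsum : ∑ k ∈ Finset.Ico 1 (N + 1), ((multipleGammaPoly N (1 / 2)).coeff k : ℂ) *
      ((2 ^ k)⁻¹ * (Real.log 2 : ℂ) * riemannZeta (-k) +
        ((2 ^ k)⁻¹ - 2) * deriv riemannZeta (-k)) =
      -((Real.log 2 : ℂ) * ∑ k ∈ Finset.Icc 1 N,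
            ((multipleGammaPoly N (1 / 2)).coeff k : ℂ) * (bernoulli (k + 1) : ℂ)
              / (((k : ℂ) + 1) * 2 ^ k)
        + ∑ k ∈ Finset.Icc 1 N,
            ((2 : ℂ) ^ (k + 1) - 1) / 2 ^ k * ((multipleGammaPoly N (1 / 2)).coeff k : ℂ)
              * deriv riemannZeta (-(k : ℂ))) := by
    rw [Finset.mul_sum, ← Finset.sum_add_distrib, ← Finset.sum_neg_distrib,
      show Finset.Ico 1 (N + 1) = Finset.Icc 1 N from rfl]
    refine Finset.sum_congr rfl fun k hk => ?_
    have hk1 : (k : ℂ) + 1 ≠ 0 := Nat.cast_add_one_ne_zero k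
    rw [riemannZeta_neg_nat_eq_neg_bernoulli (Finset.mem_Icc.1 hk).1]
    field_simp
    ring
  rw [hsum]
  push_cast
  simp only [pow_zero, neg_zero, inv_one, one_mul, zero_mul, mul_zero, zero_div, add_zero]
  rw [pow_succ]
  linear_combination (-(((2 * (N + 1) - 3).doubleFactorial : ℂ) / 2 ^ N)) * hz

open scoped Nat in
/-- The multiple gamma functions exist, are unique on `(0, ∞)`, and have the stated closed form
at `1/2`. For `n = 1` the truncated `2 * n - 3` is `0`, and `0‼ = 1` is the usual value of
`(-1)‼`. The identity is stated in `ℂ` because Mathlib's `riemannZeta` takes values there. -/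
theorem proposition2p2 :
    (∃ Γ : ℕ → ℝ → ℝ, IsMultipleGamma Γ) ∧
    (∀ Γ Γ' : ℕ → ℝ → ℝ, IsMultipleGamma Γ → IsMultipleGamma Γ' →
      ∀ n : ℕ, 1 ≤ n → Set.EqOn (Γ n) (Γ' n) (Set.Ioi 0)) ∧
    (∀ Γ : ℕ → ℝ → ℝ, IsMultipleGamma Γ → ∀ n : ℕ, 1 ≤ n →
      -(((n - 1)! : ℕ) : ℂ) * ((Real.log (Γ n (1 / 2)) : ℝ) : ℂ) =
        -(((2 * n - 3)‼ : ℕ) : ℂ) * ((Real.log Real.pi : ℝ) : ℂ) / 2 ^ n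
        + ((Real.log 2 : ℝ) : ℂ) * ∑ k ∈ Finset.Icc 1 n,
            ((multipleGammaCoeff k n (1 / 2) : ℝ) : ℂ) * ((bernoulli (k + 1) : ℚ) : ℂ)
              / (((k : ℂ) + 1) * 2 ^ k)
        + ∑ k ∈ Finset.Icc 1 n,
            ((2 : ℂ) ^ (k + 1) - 1) / 2 ^ k * ((multipleGammaCoeff k n (1 / 2) : ℝ) : ℂ)
              * deriv riemannZeta (-(k : ℂ)))  := by
  refine ⟨⟨_, isMultipleGamma_exp_logGammaDeriv⟩, fun Γ Γ' h h' n hn x hx => ?_,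
    fun Γ h n hn => ?_⟩
  · refine Real.log_injOn_pos (h.pos n hn x hx) (h'.pos n hn x hx) ?_
    rw [h.log_eq hn x hx, h'.log_eq hn x hx]
  · rw [h.log_eq hn _ (by norm_num)]
    obtain ⟨N, rfl⟩ : ∃ N, n = N + 1 := ⟨n - 1, by omega⟩
    exact logGammaDeriv_half_eq N
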